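/- For a complex Hilbert space $H$, let $K(H)$ be the C$^*$-algebra of compact operators on $H$ (with the operator norm), and let $S(K(H)^+)$ be the set of positive operators $a\in K(H)$ with $\|a\|=1$. Let $H_3$ and $H_4$ be separable complex Hilbert spaces, with $H_3$ infinite-dimensional. Let $T: K(H_3)\to K(H_4)$ be a bounded complex linear map such that $T(S(K(H_3)^+)) = S(K(H_4)^+)$ and $\|T(a)-T(b)\|=\|a-b\|$ for all $a,b\in S(K(H_3)^+)$. Then $T$ is a $^*$-isomorphism from $K(H_3)$ onto $K(H_4)$ (a bijective complex linear map with $T(x^*)=T(x)^*$ and $T(xy)=T(x)T(y)$ for all $x,y\in K(H_3)$) or a $^*$-anti-isomorphism (the same with $T(xy)=T(y)T(x)$ in place of $T(xy)=T(x)T(y)$). -/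

import Mathlib

/-- The (Hilbert space) adjoint of a compact operator is compact. -/
theorem isCompactOperator_star {H : Type*} [NormedAddCommGroup H] [InnerProductSpace ℂ H]
    [CompleteSpace H] {T : H →L[ℂ] H} (hT : IsCompactOperator T) :
    IsCompactOperator (star T : H →L[ℂ] H) := by
  have hTT : IsCompactOperator (T * star T : H →L[ℂ] H) := hT.comp_clm (star T)
  have hc := hTT.isCompact_closure_image_ball (f := (T * star T : H →L[ℂ] H).toLinearMap) 1
  have htb : TotallyBounded ((T * star T : H →L[ℂ] H) '' Metric.ball 0 1) :=
    hc.totallyBounded.subset subset_closure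
  refine (isCompactOperator_iff_isCompact_closure_image_ball
    (star T : H →L[ℂ] H).toLinearMap one_pos).2 ?_
  refine TotallyBounded.isCompact_of_isClosed (TotallyBounded.closure ?_) isClosed_closure
  rw [Metric.totallyBounded_iff]
  intro ε hε
  obtain ⟨t, hts, htf, hcov⟩ := Metric.finite_approx_of_totallyBounded htb (ε ^ 2 / 2) (by positivity)
  obtain ⟨u, hu, huf, rfl⟩ := (Set.exists_subset_image_finite_and
    (p := fun s => t = s)).1 ⟨t, hts, htf, rfl⟩
  refine ⟨(star T : H →L[ℂ] H) '' u, huf.image _, ?_⟩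
  rintro _ ⟨x, hx, rfl⟩
  have h1 := hcov ⟨x, hx, rfl⟩
  simp only [Set.mem_iUnion, Set.mem_image, exists_prop, Metric.mem_ball] at h1 ⊢
  obtain ⟨_, ⟨y, hy, rfl⟩, hd⟩ := h1
  refine ⟨_, ⟨y, hy, rfl⟩, ?_⟩
  have hy1 : ‖y‖ < 1 := by simpa using hu hy
  have hx1 : ‖x‖ < 1 := by simpa using hx
  rw [dist_eq_norm, ← map_sub] at hd
  change dist ((star T : H →L[ℂ] H) x) _ < ε
  rw [dist_eq_norm, ← map_sub]
  have key : ‖(star T : H →L[ℂ] H) (x - y)‖ ^ 2 ≤ ‖(T * star T : H →L[ℂ] H) (x - y)‖ * ‖x - y‖ := by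
    have h2 : ‖(star T : H →L[ℂ] H) (x - y)‖ ^ 2
        = RCLike.re (inner ℂ ((T * star T : H →L[ℂ] H) (x - y)) (x - y)) := by
      rw [mul_apply_eq_comp, ← ContinuousLinearMap.adjoint_inner_right,
        ← ContinuousLinearMap.star_eq_adjoint, inner_self_eq_norm_sq]
    rw [h2]
    exact re_inner_le_norm _ _
  have hxy : ‖x - y‖ ≤ 2 := (norm_sub_le x y).trans (by linarith)
  refine lt_of_pow_lt_pow_left₀ 2 hε.le ?_
  calc _ ≤ _ := key
    _ ≤ ‖(T * star T : H →L[ℂ] H) (x - y)‖ * 2 := by gcongr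
    _ < ε ^ 2 := by linarith

/-- `K(H)`: the *-algebra of compact operators on the complex Hilbert space `H`, with the
algebraic operations, adjoint and operator norm of `B(H)`. -/
def compactOperators (H : Type*) [NormedAddCommGroup H] [InnerProductSpace ℂ H]
    [CompleteSpace H] : NonUnitalStarSubalgebra ℂ (H →L[ℂ] H) where
  carrier := {a | IsCompactOperator a}
  zero_mem' := isCompactOperator_zero
  add_mem' ha hb := ha.add hb
  mul_mem' {_ b} ha _ := ha.comp_clm b
  smul_mem' c _ ha := ha.smul c
  star_mem' ha := isCompactOperator_star ha

/-- `S(K(H)⁺)`: the compact operators on `H` that are positive and have operator norm one. -/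
def positiveSphere (H : Type*) [NormedAddCommGroup H] [InnerProductSpace ℂ H]
    [CompleteSpace H] : Set (compactOperators H) :=
  {a | (a : H →L[ℂ] H).IsPositive ∧ ‖a‖ = 1}

/-! On the positive cone, `T` preserves norms and is onto by scaling, and is injective because it
preserves distances on the sphere. Order intervals therefore match, so `T` sends rank-one
projections, which span minimal rays of the cone, to rank-one projections. Orthogonality survives
because unit vectors x, y are orthogonal exactly when their projections have a sum of norm at most
1.

By spectral approximation, a self-adjoint compact operator is a limit of real combinations of
orthogonal rank-one projections. Hence `T` preserves adjoints and squares of self-adjoint elements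
(`map_mul_self_and_star_map_of_isSelfAdjoint`), and so is a Jordan *-homomorphism. It is bijective
because the cone spans, and K(H₄) is prime, so Herstein's theorem gives the dichotomy. -/

section Jordan

/-! ### Jordan homomorphisms onto prime rings. -/

variable {R S : Type*} [NonUnitalRing R] [NonUnitalRing S]

/-- In a `2`-torsion free prime ring, `u * r * v + v * r * u = 0` for all `r` forces `u = 0` or
`v = 0`. -/
theorem eq_zero_or_eq_zero_of_mul_mul_add_mul_mul (h2 : ∀ x : S, x + x = 0 → x = 0)
    (hprime : ∀ u v : S, (∀ r, u * r * v = 0) → u = 0 ∨ v = 0) {u v : S}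
    (h : ∀ r, u * r * v + v * r * u = 0) : u = 0 ∨ v = 0 := by
  have h' : ∀ r, u * r * v = -(v * r * u) := fun r => eq_neg_of_add_eq_zero_left (h r)
  refine hprime u v fun r => ?_
  -- The swap of u and v is applied twice in `h3` and once, across a longer middle factor, in `h5`;
  -- the results differ by a sign.
  have key : ∀ r', (u * r * v) * r' * (u * r * v) = 0 := fun r' => by
    apply h2
    have h3 : u * r * v * r' * (u * r * v) = v * r * v * r' * u * r * u := by
      have h4 : u * r * v * r' * v = -(v * r * v * r' * u) := by
        simpa only [mul_assoc] using h' (r * v * r')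
      calc u * r * v * r' * (u * r * v) = u * r * v * r' * -(v * r * u) := by rw [← h' r]
        _ = -(u * r * v * r' * v) * r * u := by simp only [mul_assoc, mul_neg, neg_mul]
        _ = _ := by rw [h4, neg_neg]
    have h5 : u * r * v * r' * (u * r * v) = -(v * r * v * r' * u * r * u) := by
      simpa only [mul_assoc] using h' (r * v * r' * u * r)
    exact (congrArg₂ (· + ·) h3 h5).trans (add_neg_cancel _)
  exact (hprime _ _ key).elim id id

/-- **Herstein's theorem**: an additive Jordan homomorphism onto a `2`-torsion free prime ring is
a homomorphism or an anti-homomorphism. -/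
theorem AddMonoidHom.map_mul_or_map_mul_rev_of_jordan (h2 : ∀ x : S, x + x = 0 → x = 0)
    (hprime : ∀ u v : S, (∀ r, u * r * v = 0) → u = 0 ∨ v = 0) (φ : R →+ S)
    (hsurj : Function.Surjective φ)
    (hφ : ∀ a b, φ (a * b) + φ (b * a) = φ a * φ b + φ b * φ a) :
    (∀ a b, φ (a * b) = φ a * φ b) ∨ (∀ a b, φ (a * b) = φ b * φ a) := by
  have cancel : ∀ x y : S, x + x = y + y → x = y := fun x y h =>
    sub_eq_zero.1 (h2 _ (by rw [← sub_eq_zero] at h; rw [← h]; abel))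
  have sq : ∀ a, φ (a * a) = φ a * φ a := fun a => cancel _ _ (hφ a a)
  have triple : ∀ a b, φ (a * b * a) = φ a * φ b * φ a := fun a b => by
    -- With ∘ the Jordan product xy + yx, a ∘ (a ∘ b) = a² ∘ b + 2aba.
    have e1 := hφ a (a * b + b * a)
    have e2 := hφ (a * a) b
    simp only [sq, map_add, hφ, mul_add, add_mul, ← mul_assoc] at e1 e2
    apply cancel
    have e3 : φ (a * b * a) + φ (a * b * a) =
      (φ (a * a * b) + φ (a * b * a) + (φ (a * b * a) + φ (b * a * a))) -
        (φ (a * a * b) + φ (b * a * a)) := by abel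
    rw [e3, e1, e2]
    abel
  have lin : ∀ a b c, φ (a * b * c) + φ (c * b * a) = φ a * φ b * φ c + φ c * φ b * φ a :=
    fun a b c => by
      have e := triple (a + c) b
      simp only [mul_add, add_mul, map_add, triple] at e
      have e' := sub_eq_zero.2 e
      rw [← sub_eq_zero, ← e']
      abel
  have split : ∀ a b, φ (a * b) = φ a * φ b ∨ φ (a * b) = φ b * φ a := fun a b => by
    have hor := eq_zero_or_eq_zero_of_mul_mul_add_mul_mul h2 hprime
      (u := φ (a * b) - φ a * φ b) (v := φ (a * b) - φ b * φ a) fun s => by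
        obtain ⟨r, rfl⟩ := hsurj s
        -- The image of ab·r·ba + ba·r·ab is computed twice: by `lin`, and by nesting `triple`.
        have e1 := lin (a * b) r (b * a)
        have e2 : φ (a * b * r * (b * a)) = φ a * (φ b * φ r * φ b) * φ a := by
          rw [← triple, ← triple]; simp only [mul_assoc]
        have e3 : φ (b * a * r * (a * b)) = φ b * (φ a * φ r * φ a) * φ b := by
          rw [← triple, ← triple]; simp only [mul_assoc]
        have e4 : φ (b * a) = φ a * φ b + φ b * φ a - φ (a * b) := by rw [← hφ]; abel
        rw [e2, e3, e4] at e1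
        rw [← sub_eq_zero] at e1
        rw [← e1]
        simp only [mul_add, add_mul, mul_sub, sub_mul, ← mul_assoc]
        abel
    exact hor.imp sub_eq_zero.1 sub_eq_zero.1
  -- An additive group is not the union of two proper subgroups; this is used first in b, then in a.
  have row : ∀ a, (∀ b, φ (a * b) = φ a * φ b) ∨ (∀ b, φ (a * b) = φ b * φ a) := fun a => by
    by_contra! hcon
    obtain ⟨⟨b, hb⟩, c, hc⟩ := hcon
    have hb' := (split a b).resolve_left hb
    have hc' := (split a c).resolve_right hc
    rcases split a (b + c) with h | h
    · simp only [mul_add, map_add, hc', add_left_inj] at h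
      exact hb h
    · simp only [mul_add, add_mul, map_add, hb', add_right_inj] at h
      exact hc h
  by_contra! hcon
  obtain ⟨⟨a, b, hab⟩, c, d, hcd⟩ := hcon
  have ha := (row a).resolve_left fun h => hab (h b)
  have hc := (row c).resolve_right fun h => hcd (h d)
  rcases row (a + c) with h | h
  · have := h b
    simp only [add_mul, map_add, hc, add_left_inj] at this
    exact hab this
  · have := h d
    simp only [mul_add, add_mul, map_add, ha, add_right_inj] at this
    exact hcd this

end Jordan

open InnerProductSpace

/-! ### Rank-one operators, primeness and spectral approximation in K(H). -/

section CompactOperators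

variable {H : Type*} [NormedAddCommGroup H] [InnerProductSpace ℂ H]

theorem isCompactOperator_rankOne (x y : H) : IsCompactOperator (rankOne ℂ x y : H →L[ℂ] H) :=
  (isCompactOperator_of_locallyCompactSpace_rng
    (ContinuousLinearMap.toSpanSingleton ℂ x)).comp_clm (innerSL ℂ y)

/-- Two rank-one projections whose sum is a contraction are orthogonal. -/
theorem inner_eq_zero_of_norm_rankOne_add_le {x y : H} (hx : ‖x‖ = 1)
    (h : ‖(rankOne ℂ x x + rankOne ℂ y y : H →L[ℂ] H)‖ ≤ 1) : inner ℂ x y = 0 := by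
  have h1 : ‖inner ℂ ((rankOne ℂ x x + rankOne ℂ y y : H →L[ℂ] H) x) x‖ ≤ 1 := by
    refine (norm_inner_le_norm _ _).trans ?_
    rw [hx, mul_one]
    exact (ContinuousLinearMap.le_of_opNorm_le _ h x).trans (by rw [hx, one_mul])
  have h2 : inner ℂ ((rankOne ℂ x x + rankOne ℂ y y : H →L[ℂ] H) x) x
      = ((1 + ‖(inner ℂ x y : ℂ)‖ ^ 2 : ℝ) : ℂ) := by
    rw [add_apply, inner_add_left, rankOne_apply, rankOne_apply,
      inner_smul_left, inner_smul_left, inner_self_eq_norm_sq_to_K, hx, inner_conj_symm,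
      ← inner_conj_symm y x, Complex.mul_conj, Complex.normSq_eq_norm_sq]
    simp
  rw [h2, Complex.norm_real, Real.norm_of_nonneg (by positivity)] at h1
  exact norm_eq_zero.1 (pow_eq_zero_iff two_ne_zero |>.1
    (le_antisymm (by linarith) (sq_nonneg _)))

variable [CompleteSpace H]

theorem isClosed_compactOperators : IsClosed (compactOperators H : Set (H →L[ℂ] H)) :=
  isClosed_setOfPred_isCompactOperator

/-- The rank-one operator `z ↦ ⟪y, z⟫ x` as an element of `K(H)`. -/
noncomputable def compactRankOne (x y : H) : compactOperators H :=
  ⟨rankOne ℂ x y, isCompactOperator_rankOne x y⟩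

@[simp] theorem coe_compactRankOne (x y : H) :
    (compactRankOne x y : H →L[ℂ] H) = rankOne ℂ x y := rfl

/-- `K(H)` is a prime ring. -/
theorem compactOperators_eq_zero_or_eq_zero {u v : compactOperators H}
    (h : ∀ r, u * r * v = 0) : u = 0 ∨ v = 0 := by
  by_contra! hcon
  obtain ⟨hu, hv⟩ := hcon
  have hu' : ∃ x, (u : H →L[ℂ] H) x ≠ 0 := by
    by_contra! h0
    exact hu (Subtype.ext (ContinuousLinearMap.ext h0))
  have hv' : ∃ x, (v : H →L[ℂ] H) x ≠ 0 := by
    by_contra! h0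
    exact hv (Subtype.ext (ContinuousLinearMap.ext h0))
  obtain ⟨x, hx⟩ := hu'
  obtain ⟨z, hz⟩ := hv'
  have := congrArg (fun a : compactOperators H => (a : H →L[ℂ] H) z)
    (h (compactRankOne x ((v : H →L[ℂ] H) z)))
  simp [hx, hz] at this

/-- Every self-adjoint compact operator is a difference of positive compact operators. -/
theorem exists_isPositive_sub_of_isSelfAdjoint {a : compactOperators H} (ha : IsSelfAdjoint a) :
    ∃ p q : compactOperators H, (p : H →L[ℂ] H).IsPositive ∧ (q : H →L[ℂ] H).IsPositive ∧
      a = p - q := by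
  have hcl : IsClosed (compactOperators H : Set (H →L[ℂ] H)) := isClosed_compactOperators
  have ha' : IsSelfAdjoint (a : H →L[ℂ] H) := congrArg Subtype.val ha
  refine ⟨⟨(a : H →L[ℂ] H)⁺, cfcₙ_mem _ a.2⟩, ⟨(a : H →L[ℂ] H)⁻, cfcₙ_mem _ a.2⟩,
    (ContinuousLinearMap.nonneg_iff_isPositive _).1 (CFC.posPart_nonneg _),
    (ContinuousLinearMap.nonneg_iff_isPositive _).1 (CFC.negPart_nonneg _), ?_⟩
  exact Subtype.ext (CFC.posPart_sub_negPart _ ha').symm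

theorem ContinuousLinearMap.IsPositive.exists_eq_star_mul_self {a : H →L[ℂ] H}
    (ha : a.IsPositive) : ∃ s : H →L[ℂ] H, a = star s * s :=
  CStarAlgebra.nonneg_iff_eq_star_mul_self.1 ((ContinuousLinearMap.nonneg_iff_isPositive a).2 ha)

theorem inner_star_mul_self_apply (s : H →L[ℂ] H) (x y : H) :
    inner ℂ ((star s * s) x) y = inner ℂ (s x) (s y) := by
  rw [mul_apply_eq_comp, ContinuousLinearMap.star_eq_adjoint,
    ContinuousLinearMap.adjoint_inner_left]

/-- An operator dominated by a rank-one projection is a multiple of it. -/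
theorem eq_smul_rankOne_of_le {a : H →L[ℂ] H} {x : H} (hx : ‖x‖ = 1) (ha : a.IsPositive)
    (hax : (rankOne ℂ x x - a).IsPositive) : ∃ c : ℂ, a = c • rankOne ℂ x x := by
  have hxx : inner ℂ x x = 1 := by rw [inner_self_eq_norm_sq_to_K, hx]; simp
  obtain ⟨s, rfl⟩ := ha.exists_eq_star_mul_self
  have hs : ∀ v, inner ℂ x v = 0 → s v = 0 := fun v hv => by
    have h := hax.re_inner_nonneg_left v
    rw [sub_apply, inner_sub_left, inner_star_mul_self_apply, rankOne_apply, hv,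
      zero_smul, inner_zero_left, zero_sub, map_neg, inner_self_eq_norm_sq] at h
    exact norm_eq_zero.1 (pow_eq_zero_iff two_ne_zero |>.1 (by nlinarith [sq_nonneg ‖s v‖]))
  set y := (star s * s) x with hy
  -- The component w of y orthogonal to x is killed by s, so ⟪y, w⟫ = ⟪s x, s w⟫ = 0.
  have hyx : y = inner ℂ x y • x := by
    rw [← sub_eq_zero, ← inner_self_eq_zero (𝕜 := ℂ)]
    set w := y - inner ℂ x y • x with hw
    have hxw : inner ℂ x w = 0 := by
      rw [hw, inner_sub_right, inner_smul_right, hxx, mul_one, sub_self]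
    have hyw : inner ℂ y w = 0 := by rw [hy, inner_star_mul_self_apply, hs w hxw, inner_zero_right]
    conv_lhs => rw [hw, inner_sub_left, inner_smul_left, hxw, hyw]
    simp
  refine ⟨inner ℂ x y, ContinuousLinearMap.ext fun z => ?_⟩
  have hz : s (z - inner ℂ x z • x) = 0 := hs _ (by
    rw [inner_sub_right, inner_smul_right, hxx, mul_one, sub_self])
  rw [map_sub, sub_eq_zero, map_smul] at hz
  have : (star s * s) z = inner ℂ x z • y := by
    rw [hy, mul_apply_eq_comp, hz, map_smul, mul_apply_eq_comp]
  rw [this, smul_apply, rankOne_apply, smul_smul, mul_comm, ← smul_smul, ← hyx]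

/-- A nonzero positive compact operator all of whose positive compact minorants are multiples of it
has rank one. -/
theorem exists_eq_compactRankOne {q : compactOperators H} (hq : (q : H →L[ℂ] H).IsPositive)
    (hq0 : q ≠ 0) (hmin : ∀ b : compactOperators H, (b : H →L[ℂ] H).IsPositive →
      ((q - b : compactOperators H) : H →L[ℂ] H).IsPositive → ∃ c : ℂ, b = c • q) :
    ∃ w, q = compactRankOne w w := by
  have hv : ∃ v, (q : H →L[ℂ] H) v ≠ 0 := by
    by_contra! h0
    exact hq0 (Subtype.ext (ContinuousLinearMap.ext h0))
  obtain ⟨v, hv⟩ := hv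
  obtain ⟨s, hs⟩ := hq.exists_eq_star_mul_self
  have hsv : 0 < ‖s v‖ := norm_pos_iff.2 fun h => hv (by rw [hs, mul_apply_eq_comp, h, map_zero])
  -- This scaling makes `rankOne ℂ w w` agree with q at v, while Cauchy–Schwarz for ⟪s ·, s ·⟫ keeps
  -- it below q. Minimality and evaluation at v then force equality.
  set w : H := ((‖s v‖⁻¹ : ℝ) : ℂ) • (q : H →L[ℂ] H) v with hw
  have hinner : ∀ z, inner ℂ w z = ((‖s v‖⁻¹ : ℝ) : ℂ) * inner ℂ (s v) (s z) := fun z => by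
    rw [hw, inner_smul_left, Complex.conj_ofReal, hs, inner_star_mul_self_apply]
  have hsub : ((q - compactRankOne w w : compactOperators H) : H →L[ℂ] H).IsPositive := by
    change ((q : H →L[ℂ] H) - rankOne ℂ w w).IsPositive
    rw [ContinuousLinearMap.isPositive_def']
    refine ⟨hq.isSelfAdjoint.sub (isPositive_rankOne_self w).isSelfAdjoint, fun z => ?_⟩
    rw [ContinuousLinearMap.reApplyInnerSelf_apply, sub_apply, inner_sub_left,
      rankOne_apply, inner_smul_left, RCLike.conj_mul, hs, inner_star_mul_self_apply,
      inner_self_eq_norm_sq_to_K, hinner, norm_mul, Complex.norm_real, norm_inv, norm_norm, map_sub]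
    norm_cast
    rw [sub_nonneg]
    refine pow_le_pow_left₀ (by positivity) ?_ 2
    rw [inv_mul_le_iff₀ hsv]
    exact norm_inner_le_norm _ _
  obtain ⟨c, hc⟩ := hmin (compactRankOne w w) (isPositive_rankOne_self w) hsub
  have hcv := congrArg (fun a : compactOperators H => (a : H →L[ℂ] H) v) hc
  have : c = 1 := by
    have hwv : inner ℂ w v • w = (q : H →L[ℂ] H) v := by
      rw [hinner, inner_self_eq_norm_sq_to_K, hw, smul_smul]
      convert one_smul ℂ _
      push_cast
      have : (‖s v‖ : ℂ) ≠ 0 := by exact_mod_cast hsv.ne'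
      simp
      field_simp
    have h2 : (q : H →L[ℂ] H) v = c • (q : H →L[ℂ] H) v := by
      rw [← smul_apply, ← hwv]
      exact hcv
    by_contra hne
    have : (1 - c) • (q : H →L[ℂ] H) v = 0 := by rw [sub_smul, one_smul, ← h2, sub_self]
    exact (smul_ne_zero (sub_ne_zero.2 (Ne.symm hne)) hv) this
  exact ⟨w, by rw [hc, this, one_smul]⟩

theorem norm_rankOne_add_le {x y : H} (hx : ‖x‖ = 1) (hy : ‖y‖ = 1) (hxy : inner ℂ x y = 0) :
    ‖(rankOne ℂ x x + rankOne ℂ y y : H →L[ℂ] H)‖ ≤ 1 := by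
  refine IsStarProjection.norm_le _ ((isStarProjection_rankOne_self hx).add
    (isStarProjection_rankOne_self hy) ?_)
  ext z
  simp [hxy]

/-- Self-adjoint compact operators are norm limits of real combinations of orthogonal rank-one
projections. -/
theorem exists_orthonormal_norm_sub_sum_lt {a : compactOperators H} (ha : IsSelfAdjoint a) {ε : ℝ}
    (hε : 0 < ε) : ∃ (n : ℕ) (e : Fin n → H) (c : Fin n → ℝ), Orthonormal ℂ e ∧
      ‖a - ∑ i, (c i : ℂ) • compactRankOne (e i) (e i)‖ < ε := by
  have hsa : IsSelfAdjoint (a : H →L[ℂ] H) := congrArg Subtype.val ha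
  have htb : TotallyBounded ((a : H →L[ℂ] H) '' Metric.closedBall 0 1) :=
    ((a.2.isCompact_closure_image_closedBall
      (f := (a : H →L[ℂ] H).toLinearMap) 1).totallyBounded).subset subset_closure
  obtain ⟨t, htf, htcov⟩ := Metric.totallyBounded_iff.1 htb (ε / 3) (by positivity)
  -- U is spanned by a finite net of the image of the unit ball, so P a, a P and P a P are all close
  -- to a; the compression to U is then diagonalised.
  let U : Submodule ℂ H := Submodule.span ℂ t
  have : FiniteDimensional ℂ U := FiniteDimensional.span_of_finite ℂ htf
  let P : H →L[ℂ] H := U.starProjection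
  have hPsa : star P = P := isSelfAdjoint_starProjection U
  have hP1 : ‖P‖ ≤ 1 := U.starProjection_norm_le
  have h1 : ‖(a : H →L[ℂ] H) - P * a‖ ≤ ε / 3 := by
    refine ContinuousLinearMap.opNorm_le_of_unit_norm (by positivity) fun x hx => ?_
    have hmem := htcov ⟨x, by simp [hx], rfl⟩
    simp only [Set.mem_iUnion, Metric.mem_ball, exists_prop] at hmem
    obtain ⟨y, hyt, hy⟩ := hmem
    have hPy : P y = y := Submodule.starProjection_eq_self_iff.2 (Submodule.subset_span hyt)
    have : ((a : H →L[ℂ] H) - P * a) x = Uᗮ.starProjection ((a : H →L[ℂ] H) x - y) := by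
      rw [Submodule.starProjection_orthogonal_val]
      change _ = _ - P _
      rw [map_sub, hPy, sub_apply, mul_apply_eq_comp]
      abel
    rw [this]
    refine (Uᗮ.starProjection.le_of_opNorm_le Uᗮ.starProjection_norm_le _).trans ?_
    rw [one_mul, ← dist_eq_norm]
    exact hy.le
  have h2 : ‖(a : H →L[ℂ] H) - a * P‖ ≤ ε / 3 := by
    have : (a : H →L[ℂ] H) - a * P = star ((a : H →L[ℂ] H) - P * a) := by
      rw [star_sub, star_mul, hPsa, hsa.star_eq]
    rwa [this, norm_star]
  have h3 : ‖(a : H →L[ℂ] H) - P * a * P‖ < ε := by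
    have : (a : H →L[ℂ] H) - P * a * P = (a - P * a) + P * (a - a * P) := by
      rw [mul_sub, mul_assoc]; abel
    rw [this]
    have h4 : ‖P * ((a : H →L[ℂ] H) - a * P)‖ ≤ ε / 3 :=
      (norm_mul_le _ _).trans ((mul_le_of_le_one_left (norm_nonneg _) hP1).trans h2)
    exact (norm_add_le _ _).trans_lt (by linarith)
  let A : U →ₗ[ℂ] U :=
    (U.orthogonalProjectionOnto ∘L (a : H →L[ℂ] H) ∘L U.subtypeL).toLinearMap
  have hA : A.IsSymmetric := fun x y => by
    change inner ℂ (U.orthogonalProjectionOnto ((a : H →L[ℂ] H) x)) y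
      = inner ℂ x (U.orthogonalProjectionOnto ((a : H →L[ℂ] H) y))
    rw [Submodule.inner_orthogonalProjectionOnto_eq_of_mem_right,
      Submodule.inner_orthogonalProjectionOnto_eq_of_mem_left]
    exact hsa.isSymmetric x y
  let b := hA.eigenvectorBasis rfl
  refine ⟨_, fun i => (b i : H), hA.eigenvalues rfl, b.orthonormal.comp_linearIsometry U.subtypeₗᵢ,
    ?_⟩
  have h4 : P * a * P
      = ∑ i, (hA.eigenvalues rfl i : ℂ) • (rankOne ℂ (b i : H) (b i : H) : H →L[ℂ] H) := by
    ext z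
    have hPz : P z = ∑ i, inner ℂ (b i : H) z • (b i : H) := by
      change U.starProjection z = _
      rw [b.starProjection_eq_sum_rankOne]
      simp
    have hPb : ∀ i, P ((a : H →L[ℂ] H) (b i)) = (hA.eigenvalues rfl i : ℂ) • (b i : H) := fun i =>
      congrArg Subtype.val (hA.apply_eigenvectorBasis rfl i)
    rw [mul_apply_eq_comp, mul_apply_eq_comp, hPz]
    simp only [map_sum, map_smul, hPb, _root_.sum_apply, smul_apply, rankOne_apply]
    exact Finset.sum_congr rfl fun i _ => smul_comm _ _ _
  rw [h4] at h3
  convert h3 using 1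
  change ‖((a - ∑ i, _ : compactOperators H) : H →L[ℂ] H)‖ = _
  push_cast
  rfl

end CompactOperators

/-! ### The action of T on the positive cone. -/

section PositiveSphere

variable {H : Type*} [NormedAddCommGroup H] [InnerProductSpace ℂ H] [CompleteSpace H]
  {K : Type*} [NormedAddCommGroup K] [InnerProductSpace ℂ K] [CompleteSpace K]

theorem smul_mem_positiveSphere {a : compactOperators H} (ha : (a : H →L[ℂ] H).IsPositive)
    (ha0 : a ≠ 0) : ((‖a‖⁻¹ : ℝ) : ℂ) • a ∈ positiveSphere H := by
  refine ⟨ha.smul_of_nonneg (by exact_mod_cast inv_nonneg.2 (norm_nonneg a)), ?_⟩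
  rw [norm_smul, Complex.norm_real, norm_inv, norm_norm, inv_mul_cancel₀ (norm_ne_zero_iff.2 ha0)]

theorem eq_norm_smul_inv_smul {E : Type*} [NormedAddCommGroup E] [NormedSpace ℂ E] (a : E) :
    a = (‖a‖ : ℂ) • ((‖a‖⁻¹ : ℝ) : ℂ) • a := by
  rcases eq_or_ne a 0 with rfl | h
  · simp
  · rw [smul_smul, ← Complex.ofReal_mul, mul_inv_cancel₀ (norm_ne_zero_iff.2 h), Complex.ofReal_one,
      one_smul]

theorem isPositive_map_and_norm_map_eq {T : compactOperators H →L[ℂ] compactOperators K}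
    (hT : T '' positiveSphere H = positiveSphere K) {a : compactOperators H}
    (ha : (a : H →L[ℂ] H).IsPositive) : (T a : K →L[ℂ] K).IsPositive ∧ ‖T a‖ = ‖a‖ := by
  rcases eq_or_ne a 0 with rfl | h
  · rw [T.map_zero]
    exact ⟨ContinuousLinearMap.isPositive_zero, by rw [norm_zero, norm_zero]⟩
  · obtain ⟨h1, h2⟩ := hT ▸ Set.mem_image_of_mem T (smul_mem_positiveSphere ha h)
    have e : T a = (‖a‖ : ℂ) • T (((‖a‖⁻¹ : ℝ) : ℂ) • a) := by
      rw [← map_smul, ← eq_norm_smul_inv_smul]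
    rw [e]
    refine ⟨h1.smul_of_nonneg (by exact_mod_cast norm_nonneg a), ?_⟩
    rw [norm_smul, h2, mul_one, Complex.norm_real, norm_norm]

theorem exists_isPositive_map_eq {T : compactOperators H →L[ℂ] compactOperators K}
    (hT : T '' positiveSphere H = positiveSphere K) {b : compactOperators K}
    (hb : (b : K →L[ℂ] K).IsPositive) :
    ∃ a : compactOperators H, (a : H →L[ℂ] H).IsPositive ∧ T a = b := by
  rcases eq_or_ne b 0 with rfl | h
  · exact ⟨0, ContinuousLinearMap.isPositive_zero, T.map_zero⟩
  · obtain ⟨a, ha, hab⟩ := hT.symm ▸ smul_mem_positiveSphere hb h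
    refine ⟨(‖b‖ : ℂ) • a, ha.1.smul_of_nonneg (by exact_mod_cast norm_nonneg b), ?_⟩
    rw [map_smul, hab, ← eq_norm_smul_inv_smul]

/-- Equal images force equal norms, so both elements rescale by the same factor to the sphere, where
distances are preserved. -/
theorem eq_of_isPositive_of_map_eq {T : compactOperators H →L[ℂ] compactOperators K}
    (hT : T '' positiveSphere H = positiveSphere K)
    (hiso : ∀ a ∈ positiveSphere H, ∀ b ∈ positiveSphere H, ‖T a - T b‖ = ‖a - b‖)
    {a b : compactOperators H} (ha : (a : H →L[ℂ] H).IsPositive) (hb : (b : H →L[ℂ] H).IsPositive)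
    (hab : T a = T b) : a = b := by
  have hn : ‖a‖ = ‖b‖ := by
    rw [← (isPositive_map_and_norm_map_eq hT ha).2, hab, (isPositive_map_and_norm_map_eq hT hb).2]
  rcases eq_or_ne a 0 with rfl | h
  · exact (norm_eq_zero.1 (hn ▸ norm_zero)).symm
  · have hb0 : b ≠ 0 := norm_ne_zero_iff.1 (hn ▸ norm_ne_zero_iff.2 h)
    have e := hiso _ (smul_mem_positiveSphere ha h) _ (smul_mem_positiveSphere hb hb0)
    rw [map_smul, map_smul, hab, hn, sub_self, norm_zero, eq_comm, norm_sub_eq_zero_iff] at e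
    rw [eq_norm_smul_inv_smul a, eq_norm_smul_inv_smul b, hn, e]

theorem exists_map_compactRankOne_eq {T : compactOperators H →L[ℂ] compactOperators K}
    (hT : T '' positiveSphere H = positiveSphere K)
    (hiso : ∀ a ∈ positiveSphere H, ∀ b ∈ positiveSphere H, ‖T a - T b‖ = ‖a - b‖)
    {x : H} (hx : ‖x‖ = 1) :
    ∃ y : K, ‖y‖ = 1 ∧ T (compactRankOne x x) = compactRankOne y y := by
  have hp : (compactRankOne x x : H →L[ℂ] H).IsPositive := isPositive_rankOne_self x
  obtain ⟨hTp, hTn⟩ := isPositive_map_and_norm_map_eq hT hp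
  have hn : ‖T (compactRankOne x x)‖ = 1 := by
    rw [hTn]
    change ‖rankOne ℂ x x‖ = 1
    rw [norm_rankOne, hx, mul_one]
  have hex : ∃ y, T (compactRankOne x x) = compactRankOne y y := by
    refine exists_eq_compactRankOne hTp (norm_ne_zero_iff.1 (by rw [hn]; exact one_ne_zero))
      fun b hb hb' => ?_
    -- Both b and its complement lift to the cone; injectivity there makes the lifts sum to the
    -- projection, so a lies below it.
    obtain ⟨a, ha, rfl⟩ := exists_isPositive_map_eq hT hb
    obtain ⟨c, hc, hcb⟩ := exists_isPositive_map_eq hT hb'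
    have hac : a + c = compactRankOne x x :=
      eq_of_isPositive_of_map_eq hT hiso (ha.add hc) hp (by rw [map_add, hcb, add_sub_cancel])
    obtain ⟨r, hr⟩ := eq_smul_rankOne_of_le hx ha (by
      have : (rankOne ℂ x x : H →L[ℂ] H) - a = c := by
        rw [← coe_compactRankOne, ← hac]; exact add_sub_cancel_left _ _
      rwa [this])
    exact ⟨r, by rw [← map_smul]; exact congrArg T (Subtype.ext hr)⟩
  obtain ⟨y, hy⟩ := hex
  refine ⟨y, ?_, hy⟩
  rw [hy] at hn
  change ‖rankOne ℂ y y‖ = 1 at hn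
  rw [norm_rankOne] at hn
  nlinarith [norm_nonneg y]

theorem inner_eq_zero_of_map_compactRankOne_eq {T : compactOperators H →L[ℂ] compactOperators K}
    (hT : T '' positiveSphere H = positiveSphere K) {x x' : H} {y y' : K} (hx : ‖x‖ = 1)
    (hx' : ‖x'‖ = 1) (hxx' : inner ℂ x x' = 0) (hy : ‖y‖ = 1)
    (h : T (compactRankOne x x) = compactRankOne y y)
    (h' : T (compactRankOne x' x') = compactRankOne y' y') : inner ℂ y y' = 0 := by
  refine inner_eq_zero_of_norm_rankOne_add_le hy ?_
  change ‖compactRankOne y y + compactRankOne y' y'‖ ≤ 1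
  rw [← h, ← h', ← map_add, (isPositive_map_and_norm_map_eq hT
    ((isPositive_rankOne_self x).add (isPositive_rankOne_self x'))).2]
  exact norm_rankOne_add_le hx hx' hxx'

theorem ContinuousLinearMap.map_sum_smul {ι E F : Type*} [NormedAddCommGroup E] [NormedSpace ℂ E]
    [NormedAddCommGroup F] [NormedSpace ℂ F] (T : E →L[ℂ] F) (s : Finset ι) (c : ι → ℂ)
    (x : ι → E) : T (∑ i ∈ s, c i • x i) = ∑ i ∈ s, c i • T (x i) := by
  simp

theorem star_compactRankOne_self (x : H) : star (compactRankOne x x) = compactRankOne x x :=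
  Subtype.ext (isPositive_rankOne_self x).isSelfAdjoint

theorem sum_compactRankOne_mul_self {n : ℕ} {e : Fin n → H} (he : Orthonormal ℂ e) (c : Fin n → ℝ) :
    (∑ i, (c i : ℂ) • compactRankOne (e i) (e i)) * (∑ i, (c i : ℂ) • compactRankOne (e i) (e i))
      = ∑ i, ((c i : ℂ) * c i) • compactRankOne (e i) (e i) := by
  have hmul : ∀ i j, compactRankOne (e i) (e i) * compactRankOne (e j) (e j)
      = if i = j then compactRankOne (e i) (e i) else 0 := fun i j => by
    have hij := orthonormal_iff_ite.1 he i j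
    refine Subtype.ext (ContinuousLinearMap.ext fun z => ?_)
    change rankOne ℂ (e i) (e i) (rankOne ℂ (e j) (e j) z) = _
    rw [rankOne_apply, rankOne_apply, inner_smul_right, hij]
    split_ifs with h
    · subst h; simp
    · simp
  simp_rw [Finset.sum_mul, Finset.mul_sum, smul_mul_smul_comm, hmul, smul_ite, smul_zero,
    Finset.sum_ite_eq, Finset.mem_univ, if_true]

/-- Both identities are closed conditions, and on a finite diagonal combination T only replaces one
orthonormal family by another. -/
theorem map_mul_self_and_star_map_of_isSelfAdjoint
    {T : compactOperators H →L[ℂ] compactOperators K}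
    (hT : T '' positiveSphere H = positiveSphere K)
    (hiso : ∀ a ∈ positiveSphere H, ∀ b ∈ positiveSphere H, ‖T a - T b‖ = ‖a - b‖)
    {a : compactOperators H} (ha : IsSelfAdjoint a) : T (a * a) = T a * T a ∧ star (T a) = T a := by
  have hclosed : IsClosed {x : compactOperators H | T (x * x) = T x * T x ∧ star (T x) = T x} := by
    have h1 : Continuous fun x : compactOperators H => x * x := continuous_id.mul continuous_id
    have h2 : Continuous fun x : compactOperators K => star x :=
      (continuous_star.comp continuous_subtype_val).subtype_mk _
    exact (isClosed_eq (T.continuous.comp h1) (T.continuous.mul T.continuous)).inter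
      (isClosed_eq (h2.comp T.continuous) T.continuous)
  refine hclosed.closure_subset (Metric.mem_closure_iff.2 fun ε hε => ?_)
  obtain ⟨n, e, c, he, hlt⟩ := exists_orthonormal_norm_sub_sum_lt ha hε
  refine ⟨_, ?_, by rw [dist_eq_norm]; exact hlt⟩
  choose f hf hTf using fun i => exists_map_compactRankOne_eq hT hiso (he.1 i)
  have hfo : Orthonormal ℂ f := ⟨hf, fun i j hij =>
    inner_eq_zero_of_map_compactRankOne_eq hT (he.1 i) (he.1 j) (he.2 hij) (hf i) (hTf i) (hTf j)⟩
  have hTs : T (∑ i, (c i : ℂ) • compactRankOne (e i) (e i))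
      = ∑ i, (c i : ℂ) • compactRankOne (f i) (f i) := by
    simp_rw [T.map_sum_smul, hTf]
  refine ⟨?_, ?_⟩
  · rw [hTs, sum_compactRankOne_mul_self he, sum_compactRankOne_mul_self hfo, T.map_sum_smul]
    simp_rw [hTf]
  · rw [hTs, star_sum]
    simp_rw [star_smul, star_compactRankOne_self, Complex.star_def, Complex.conj_ofReal]

end PositiveSphere

/-! ### From self-adjoint elements to the whole star algebra. -/

section StarAlgebra

theorem map_mul_add_mul_of_isSelfAdjoint {R S : Type*} [NonUnitalRing R] [StarRing R]
    [NonUnitalRing S] (φ : R →+ S) (h : ∀ a, IsSelfAdjoint a → φ (a * a) = φ a * φ a) {a b : R}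
    (ha : IsSelfAdjoint a) (hb : IsSelfAdjoint b) :
    φ (a * b) + φ (b * a) = φ a * φ b + φ b * φ a := by
  have e := h _ (ha.add hb)
  simp only [mul_add, add_mul, map_add, h a ha, h b hb] at e
  rw [← sub_eq_zero] at e ⊢
  rw [← e]
  abel


/-- A complex linear bijection between star algebras, the codomain being prime, which preserves
self-adjointness and squares of self-adjoint elements is a star isomorphism or a star
anti-isomorphism. -/
theorem LinearMap.exists_starAlgEquiv_or_of_map_mul_self {R S : Type*}
    [NonUnitalRing R] [StarRing R] [Module ℂ R] [IsScalarTower ℂ R R] [SMulCommClass ℂ R R]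
    [StarModule ℂ R] [NonUnitalRing S] [StarRing S] [Module ℂ S] [IsScalarTower ℂ S S]
    [SMulCommClass ℂ S S] [StarModule ℂ S]
    (hprime : ∀ u v : S, (∀ r, u * r * v = 0) → u = 0 ∨ v = 0) (T : R →ₗ[ℂ] S)
    (hsa : ∀ a, IsSelfAdjoint a → T (a * a) = T a * T a ∧ star (T a) = T a)
    (hpos : ∀ b : S, IsSelfAdjoint b → ∃ a, T a = b)
    (hzero : ∀ a, IsSelfAdjoint a → T a = 0 → a = 0) :
    (∃ Φ : R ≃⋆ₐ[ℂ] S, ∀ x, Φ x = T x) ∨ (∃ Φ : R ≃⋆ₐ[ℂ] Sᵐᵒᵖ, ∀ x, Φ x = MulOpposite.op (T x)) := by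
  have hdec : ∀ x : R, ∃ a b : R,
      IsSelfAdjoint a ∧ IsSelfAdjoint b ∧ x = a + Complex.I • b := fun x =>
    ⟨realPart x, imaginaryPart x, (realPart x).2, (imaginaryPart x).2,
      (realPart_add_I_smul_imaginaryPart x).symm⟩
  have hstar : ∀ x, T (star x) = star (T x) := fun x => by
    obtain ⟨a, b, ha, hb, rfl⟩ := hdec x
    simp [ha.star_eq, hb.star_eq, (hsa a ha).2, (hsa b hb).2]
  have hjordan : ∀ x y, T (x * y) + T (y * x) = T x * T y + T y * T x := fun x y => by
    have hJ : ∀ a b : R, IsSelfAdjoint a → IsSelfAdjoint b →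
        T (a * b) + T (b * a) = T a * T b + T b * T a := fun a b ha hb =>
      map_mul_add_mul_of_isSelfAdjoint T.toAddMonoidHom (fun a ha => (hsa a ha).1) ha hb
    obtain ⟨a, b, ha, hb, rfl⟩ := hdec x
    obtain ⟨c, d, hc, hd, rfl⟩ := hdec y
    have e1 := hJ a c ha hc
    have e2 := congrArg (Complex.I • ·) (hJ a d ha hd)
    have e3 := congrArg (Complex.I • ·) (hJ b c hb hc)
    have e4 := congrArg (Complex.I • Complex.I • ·) (hJ b d hb hd)
    have e := congrArg₂ (· + ·) (congrArg₂ (· + ·) e1 e2) (congrArg₂ (· + ·) e3 e4)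
    simp only [smul_add, map_add, map_smul, mul_add, add_mul, smul_mul_assoc, mul_smul_comm] at e ⊢
    rw [← sub_eq_zero] at e ⊢
    rw [← e]
    abel
  have hsurj : Function.Surjective T := fun y => by
    obtain ⟨a, ha⟩ := hpos (realPart y) (realPart y).2
    obtain ⟨b, hb⟩ := hpos (imaginaryPart y) (imaginaryPart y).2
    exact ⟨a + Complex.I • b, by
      rw [T.map_add, map_smul, ha, hb, realPart_add_I_smul_imaginaryPart]⟩
  have hinj : Function.Injective T := by
    -- The kernel is star-closed, so it contains the self-adjoint elements x + x* and i(x − x*).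
    refine (injective_iff_map_eq_zero T).2 fun x hx => ?_
    have hx' : T (star x) = 0 := by rw [hstar, hx, star_zero]
    have h1 : x + star x = 0 := hzero _ (IsSelfAdjoint.add_star_self x) (by
      rw [T.map_add, hx, hx', add_zero])
    have h2 : Complex.I • (x - star x) = 0 := hzero _ (by
      rw [IsSelfAdjoint, star_smul, star_sub, star_star, Complex.star_def, Complex.conj_I, neg_smul,
        ← smul_neg, neg_sub]) (by
      rw [T.map_smul, map_sub, hx, hx', sub_zero, smul_zero])
    have h3 : x - star x = 0 := (smul_eq_zero.1 h2).resolve_left Complex.I_ne_zero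
    rw [sub_eq_zero] at h3
    rw [← h3, ← two_smul ℂ x] at h1
    exact (smul_eq_zero.1 h1).resolve_left two_ne_zero
  let e := Equiv.ofBijective T ⟨hinj, hsurj⟩
  rcases AddMonoidHom.map_mul_or_map_mul_rev_of_jordan
    (fun x h => (smul_eq_zero.1 ((two_smul ℂ x).trans h)).resolve_left two_ne_zero)
    hprime
    T.toAddMonoidHom hsurj hjordan with h | h
  · exact Or.inl ⟨{ e with
      map_mul' := h
      map_add' := T.map_add
      map_star' := hstar
      map_smul' := T.map_smul }, fun _ => rfl⟩
  · exact Or.inr ⟨{ e.trans MulOpposite.opEquiv with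
      map_mul' := fun x y => congrArg MulOpposite.op (h x y)
      map_add' := fun x y => congrArg MulOpposite.op (T.map_add x y)
      map_star' := fun x => congrArg MulOpposite.op (hstar x)
      map_smul' := fun c x => congrArg MulOpposite.op (T.map_smul c x) }, fun _ => rfl⟩

end StarAlgebra

theorem corollaryc {H₃ H₄ : Type*}
    [NormedAddCommGroup H₃] [InnerProductSpace ℂ H₃] [CompleteSpace H₃]
    [NormedAddCommGroup H₄] [InnerProductSpace ℂ H₄] [CompleteSpace H₄]
    [TopologicalSpace.SeparableSpace H₃] [TopologicalSpace.SeparableSpace H₄]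
    (hH₃ : ¬ FiniteDimensional ℂ H₃)
    (T : compactOperators H₃ →L[ℂ] compactOperators H₄)
    (hT : T '' positiveSphere H₃ = positiveSphere H₄)
    (hiso : ∀ a ∈ positiveSphere H₃, ∀ b ∈ positiveSphere H₃, ‖T a - T b‖ = ‖a - b‖) :
    (∃ Φ : compactOperators H₃ ≃⋆ₐ[ℂ] compactOperators H₄, ∀ x, Φ x = T x) ∨
    (∃ Φ : compactOperators H₃ ≃⋆ₐ[ℂ] (compactOperators H₄)ᵐᵒᵖ,
      ∀ x, Φ x = MulOpposite.op (T x)) := by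
  refine LinearMap.exists_starAlgEquiv_or_of_map_mul_self
    (fun _ _ => compactOperators_eq_zero_or_eq_zero) T.toLinearMap
    (fun a ha => map_mul_self_and_star_map_of_isSelfAdjoint hT hiso ha) (fun b hb => ?_)
    fun a ha h0 => ?_
  · obtain ⟨p, q, hp, hq, rfl⟩ := exists_isPositive_sub_of_isSelfAdjoint hb
    obtain ⟨p', -, rfl⟩ := exists_isPositive_map_eq hT hp
    obtain ⟨q', -, rfl⟩ := exists_isPositive_map_eq hT hq
    exact ⟨p' - q', T.map_sub _ _⟩
  · obtain ⟨p, q, hp, hq, rfl⟩ := exists_isPositive_sub_of_isSelfAdjoint ha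
    have h1 : T p - T q = 0 := (T.map_sub p q).symm.trans h0
    rw [eq_of_isPositive_of_map_eq hT hiso hp hq (sub_eq_zero.1 h1), sub_self]
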